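/- \textbf{Theorem (Nuclearity of $\mathcal{A}_\sigma(G)$).} Let $G$ be a finitely generated infinite group, let $S = S^{-1} \subseteq G$ be a finite symmetric generating set, let $L\colon G \to \mathbb{N}_0$ be the corresponding word length (so $L(g)$ is the minimal number of elements of $S$ needed to write $g$ as a product, and $L(e)=0$), and let $\beta_G(n) = \#\{g \in G \mid L(g) \le n\}$ be the volume growth of $G$. Let $\sigma\colon \mathbb{N}_0 \to [1,\infty)$ be a growth function, i.e. $\sigma$ is monotonically increasing and unbounded, and assume that $\sigma$ is almost submultiplicative: for every $\epsilon > 0$ there is a constant $c > 0$ with $\sigma(n+m) \le c\, \sigma(n)^{1+\epsilon} \sigma(m)^{1+\epsilon}$ for all $n, m \in \mathbb{N}_0$. For functions $\sigma_1, \sigma_2\colon \mathbb{N}_0 \to [1,\infty)$ write $\sigma_1 \preccurlyeq \sigma_2$ if there are an integer $c \ge 1$ and a real number $k \ge 1$ with $\sigma_1(n) \le c\, \sigma_2(cn)^k$ for all $n \in \mathbb{N}_0$. Assume that $(1+n) \preccurlyeq \sigma$. For $R \ge 0$ and a formal sum $a = \sum_{g \in G} a_g \mathrm{e}_g$ with complex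 coefficients put $\|a\|_{L,\sigma,R} = \sum_{g \in G} |a_g|\, \sigma(L(g))^R \in [0,\infty]$ and $\ell^1_{L,\sigma,R}(G) = \{a \mid \|a\|_{L,\sigma,R} < \infty\}$. Let $$\mathcal{A}_\sigma(G) = \bigcap_{R \ge 0} \ell^1_{L,\sigma,R}(G),$$ equipped with the locally convex topology defined by all the norms $\|\cdot\|_{L,\sigma,R}$, $R \ge 0$. Then $\mathcal{A}_\sigma(G)$ is nuclear if and only if $\beta_G \preccurlyeq \sigma$. Here a locally convex space $E$ is called nuclear if for every continuous seminorm $p$ on $E$ there is a continuous seminorm $q \ge p$ such that the canonical map $E_q \to E_p$ is a nuclear operator, where $E_p$ denotes the Banach space completion of $E/\ker p$ with respect to $p$; and a continuous linear map $T\colon X \to Y$ between Banach spaces is called nuclear if there are continuous linear functionals $f_n$ on $X$ and vectors $y_n \in Y$ with $\sum_n \|f_n\|\,\|y_n\| < \infty$ and $Tx = \sum_n f_n(x)\, y_n$ for all $x \in X$. -/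

import Mathlib

noncomputable section

namespace WeightedGroup

open scoped NNReal

/-! ### Nuclear operators and nuclear locally convex spaces -/

/-- A continuous linear map between Banach spaces is nuclear if
`T x = ∑ₙ fₙ(x) yₙ` with continuous functionals `fₙ` and vectors `yₙ` such that
`∑ₙ ‖fₙ‖ ‖yₙ‖ < ∞`. -/
def IsNuclearOperator {X Y : Type*} [NormedAddCommGroup X] [NormedSpace ℂ X]
    [NormedAddCommGroup Y] [NormedSpace ℂ Y] (T : X →L[ℂ] Y) : Prop :=
  ∃ (f : ℕ → (X →L[ℂ] ℂ)) (y : ℕ → Y),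
    Summable (fun n => ‖f n‖ * ‖y n‖) ∧ ∀ x : X, HasSum (fun n => f n x • y n) (T x)

/-- The vector space `E`, viewed as a seminormed space by means of the seminorm `p`. -/
def WithSeminorm {E : Type*} [AddCommGroup E] [Module ℂ E] (_p : Seminorm ℂ E) : Type _ := E

section WithSeminorm

variable {E : Type*} [AddCommGroup E] [Module ℂ E]

instance (p : Seminorm ℂ E) : SeminormedAddCommGroup (WithSeminorm p) :=
  p.toAddGroupSeminorm.toSeminormedAddCommGroup

instance (p : Seminorm ℂ E) : NormedSpace ℂ (WithSeminorm p) where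
  toModule := inferInstanceAs (Module ℂ E)
  norm_smul_le a x := (map_smul_eq_mul p a x).le

/-- The identity of `E` as a continuous map `(E, q) → (E, p)` for `p ≤ q`. -/
def WithSeminorm.idOfLE {p q : Seminorm ℂ E} (h : p ≤ q) : WithSeminorm q →L[ℂ] WithSeminorm p :=
  LinearMap.mkContinuous
    ({ toFun := fun x => x, map_add' := fun _ _ => rfl, map_smul' := fun _ _ => rfl } :
      WithSeminorm q →ₗ[ℂ] WithSeminorm p)
    1 (fun x => (h x).trans (one_mul (q x)).ge)

/-- The local Banach space `E_p` of a seminorm `p`: the Hausdorff completion of `(E, p)`,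
i.e. the completion of `E / ker p`. -/
abbrev LocalBanach (p : Seminorm ℂ E) : Type _ := UniformSpace.Completion (WithSeminorm p)

/-- The canonical linking map `E_q → E_p` between local Banach spaces for `p ≤ q`. -/
def linkingMap {p q : Seminorm ℂ E} (h : p ≤ q) : LocalBanach q →L[ℂ] LocalBanach p :=
  (WithSeminorm.idOfLE h).completion

end WithSeminorm

/-- A locally convex space is nuclear if for every continuous seminorm `p` there is a continuous
seminorm `q ≥ p` such that the canonical map `E_q → E_p` between the local Banach spaces is
nuclear. -/
def IsNuclearSpace (E : Type*) [AddCommGroup E] [Module ℂ E] [TopologicalSpace E]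
    [PolynormableSpace ℂ E] : Prop :=
  ∀ p : Seminorm ℂ E, Continuous p →
    ∃ q : Seminorm ℂ E, Continuous q ∧ ∃ h : p ≤ q, IsNuclearOperator (linkingMap h)

/-! ### Growth functions -/

/-- A growth function: a monotonically increasing and unbounded map `ℕ → [1, ∞)`. -/
structure GrowthFunction where
  /-- the underlying function -/
  toFun : ℕ → ℝ
  one_le : ∀ n, 1 ≤ toFun n
  mono : Monotone toFun
  unbounded : ¬ BddAbove (Set.range toFun)

instance : CoeFun GrowthFunction (fun _ => ℕ → ℝ) := ⟨GrowthFunction.toFun⟩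

/-- For every `ε > 0` there is `c > 0` with
`σ (n + m) ≤ c * σ n ^ (1 + ε) * σ m ^ (1 + ε)` for all `n`, `m`. -/
def AlmostSubmultiplicative (σ : ℕ → ℝ) : Prop :=
  ∀ ε : ℝ, 0 < ε → ∃ c : ℝ, 0 < c ∧
    ∀ n m : ℕ, σ (n + m) ≤ c * σ n ^ (1 + ε) * σ m ^ (1 + ε)

/-- The relation `σ₁ ≼ σ₂` on functions `ℕ → [1, ∞)`: there are constants `c, k ≥ 1` with
`σ₁ n ≤ c * σ₂ (c * n) ^ k` for all `n`. -/
def GrowthLE (σ₁ σ₂ : ℕ → ℝ) : Prop :=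
  ∃ (c : ℕ) (k : ℝ), 1 ≤ c ∧ 1 ≤ k ∧ ∀ n : ℕ, σ₁ n ≤ (c : ℝ) * σ₂ (c * n) ^ k

/-! ### Word length and volume growth -/

section Group

variable {G : Type*} [Group G]

/-- The word length of `g`: the least length of a word in letters from `S` with product `g`. -/
def wordLength (S : Set G) (g : G) : ℕ :=
  sInf {n : ℕ | ∃ w : List G, (∀ s ∈ w, s ∈ S) ∧ w.prod = g ∧ w.length = n}

/-- The volume growth `β_G(n) = #{g | L(g) ≤ n}` of a group with length function `L`. -/
def volumeGrowth (L : G → ℕ) (n : ℕ) : ℝ :=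
  (Set.ncard {g : G | L g ≤ n} : ℝ)

end Group

/-! ### Weighted `ℓ¹`-spaces and their intersection -/

section Spaces

variable {G : Type*}

lemma weight_nonneg (L : G → ℕ) (σ : GrowthFunction) (R : ℝ≥0) (g : G) :
    0 ≤ σ (L g) ^ (R : ℝ) :=
  Real.rpow_nonneg (zero_le_one.trans (σ.one_le _)) _

/-- The space `ℓ¹_{L,σ,R}(G)` of all formal sums `a = ∑ a_g e_g` with
`∑_g |a_g| σ(L(g))^R < ∞`. -/
def weightedEllOne (L : G → ℕ) (σ : GrowthFunction) (R : ℝ≥0) : Submodule ℂ (G → ℂ) where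
  carrier := {a | Summable fun g => ‖a g‖ * σ (L g) ^ (R : ℝ)}
  zero_mem' := by simp [summable_zero]
  add_mem' := by
    intro a b ha hb
    refine Summable.of_nonneg_of_le
      (fun g => mul_nonneg (norm_nonneg _) (weight_nonneg L σ R g)) (fun g => ?_) (ha.add hb)
    rw [← add_mul]
    exact mul_le_mul_of_nonneg_right (norm_add_le _ _) (weight_nonneg L σ R g)
  smul_mem' := by
    intro c a ha
    simpa [mul_assoc] using ha.mul_left ‖c‖

/-- The space `A_σ(G) = ⋂_{R ≥ 0} ℓ¹_{L,σ,R}(G)`, as a type of its own, since its topology is not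
the one inherited from the product `G → ℂ`. -/
def ASigma (L : G → ℕ) (σ : GrowthFunction) : Type _ :=
  ↥(⨅ R : ℝ≥0, weightedEllOne L σ R)

variable (L : G → ℕ) (σ : GrowthFunction)

instance : AddCommGroup (ASigma L σ) :=
  inferInstanceAs (AddCommGroup ↥(⨅ R : ℝ≥0, weightedEllOne L σ R))

instance : Module ℂ (ASigma L σ) :=
  inferInstanceAs (Module ℂ ↥(⨅ R : ℝ≥0, weightedEllOne L σ R))

/-- The coefficients `a_g` of `a ∈ A_σ(G)`. -/
def ASigma.coeff {L : G → ℕ} {σ : GrowthFunction} (a : ASigma L σ) : G → ℂ :=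
  Subtype.val a

variable {L σ} in
lemma ASigma.summable (a : ASigma L σ) (R : ℝ≥0) :
    Summable fun g => ‖a.coeff g‖ * σ (L g) ^ (R : ℝ) :=
  (Submodule.mem_iInf _).1 (Subtype.property a) R

/-- The norm `‖a‖_{L,σ,R} = ∑_g |a_g| σ(L(g))^R` on `A_σ(G)`. -/
def ASigma.weightedNorm (R : ℝ≥0) : Seminorm ℂ (ASigma L σ) :=
  Seminorm.of (fun a => ∑' g, ‖a.coeff g‖ * σ (L g) ^ (R : ℝ))
    (by
      intro a b
      rw [← (a.summable R).tsum_add (b.summable R)]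
      refine ((a + b).summable R).tsum_le_tsum (fun g => ?_)
        ((a.summable R).add (b.summable R))
      rw [← add_mul]
      exact mul_le_mul_of_nonneg_right (norm_add_le _ _) (weight_nonneg L σ R g))
    (by
      intro c a
      rw [← tsum_mul_left]
      refine tsum_congr fun g => ?_
      rw [← mul_assoc]
      congr 1
      exact norm_mul c (a.coeff g))

/-- The locally convex topology of `A_σ(G)`, defined by all the norms `‖·‖_{L,σ,R}`, `R ≥ 0`. -/
instance : TopologicalSpace (ASigma L σ) :=
  (SeminormFamily.moduleFilterBasis (𝕜 := ℂ) (ASigma.weightedNorm L σ)).topology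

lemma ASigma.withSeminorms : WithSeminorms (𝕜 := ℂ) (ASigma.weightedNorm L σ) := ⟨rfl⟩

instance : PolynormableSpace ℂ (ASigma L σ) :=
  (ASigma.withSeminorms L σ).toPolynormableSpace

end Spaces

end WeightedGroup

end

/-!
The coefficient functionals and the vectors `e_g` form an absolute basis of `A_σ(G)`: one has
`a = ∑ a_g e_g` with respect to every continuous seminorm, and `‖e_g‖_{L,σ,R} = σ(L g)^R`.
Nuclearity therefore amounts to the summability of some negative power of the weight,
`∑_g σ(L g)^{-M} < ∞`, a form of the Grothendieck–Pietsch criterion.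

* If the sum is finite, then a continuous seminorm bounded by `C ‖·‖_R` is compared with
  `C ‖·‖_{R+M}`, and the expansion in the basis is a nuclear representation of the linking map
  (`ASigma.isNuclearSpace_of_summable`).
* Conversely, if `E_q → E_p` is nuclear for `p = ‖·‖_0` and some `q ≤ C ‖·‖_R`, with representation
  `∑ₙ fₙ ⊗ yₙ`, then evaluating the `g`-th coefficient of the image of `e_g` gives
  `1 ≤ C σ(L g)^R ∑ₙ ‖fₙ‖ |(yₙ)_g|`. Dividing by the weight and summing over `g` bounds
  `∑_g σ(L g)^{-R}` by `C ∑ₙ ‖fₙ‖ ‖yₙ‖` (`IsNuclearOperator.exists_sum_inv_le`).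

Restricting the sum to the ball of radius `n` yields `β(n) ≤ C' σ(n)^R`, as `σ` is increasing. In the
other direction, almost submultiplicativity removes the rescaling of the argument in `≼`, so that
`β(n) (1 + n)² ≤ C σ(n)^M`, and `∑_g 1 / (β(L g) (1 + L g)²)` converges because every sphere is
contained in the ball of the same radius (`summable_inv_volumeGrowth_mul`).
-/

namespace WeightedGroup

open scoped NNReal
open Filter Topology

/-! ### Nuclear operators between local Banach spaces -/

/-- An absolutely convergent expansion of `T` that holds on a dense set holds everywhere, since
it converges in operator norm; hence it exhibits `T` as a nuclear operator. -/
lemma isNuclearOperator_of_hasSum_of_dense {X Y : Type*} [NormedAddCommGroup X] [NormedSpace ℂ X]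
    [NormedAddCommGroup Y] [NormedSpace ℂ Y] [CompleteSpace Y] (T : X →L[ℂ] Y) {ι : Type*}
    [Countable ι] [Infinite ι] (f : ι → (X →L[ℂ] ℂ)) (y : ι → Y)
    (hfy : Summable fun i => ‖f i‖ * ‖y i‖) {D : Type*} {d : D → X} (hd : DenseRange d)
    (hexp : ∀ x, HasSum (fun i => f i (d x) • y i) (T (d x))) : IsNuclearOperator T := by
  obtain ⟨u⟩ := nonempty_equiv_of_countable (α := ℕ) (β := ι)
  have hop : Summable fun i => (f i).smulRight (y i) := by
    refine Summable.of_norm ?_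
    simpa only [ContinuousLinearMap.norm_smulRight_apply] using hfy
  have hop' : ∀ x, HasSum (fun i => f i x • y i) ((∑' i, (f i).smulRight (y i)) x) := fun x =>
    hop.hasSum.mapL (ContinuousLinearMap.apply ℂ Y x)
  have key : ⇑(∑' i, (f i).smulRight (y i)) = T :=
    hd.equalizer (ContinuousLinearMap.continuous _) T.continuous
      (funext fun x => (hop' _).unique (hexp x))
  refine ⟨fun n => f (u n), fun n => y (u n), u.summable_iff.2 hfy, fun x => ?_⟩
  rw [← key]
  exact u.hasSum_iff.2 (hop' x)

section LocalBanach

variable {E : Type*} [AddCommGroup E] [Module ℂ E]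

/-- The extension to `E_p` of a linear functional on `E` that is bounded by a multiple of `p`. -/
noncomputable def LocalBanach.functional (p : Seminorm ℂ E) (φ : E →ₗ[ℂ] ℂ) (b : ℝ)
    (hb : ∀ x, ‖φ x‖ ≤ b * p x) : LocalBanach p →L[ℂ] ℂ :=
  (LinearMap.mkContinuous
    ({ toFun := fun x => φ x, map_add' := φ.map_add, map_smul' := φ.map_smul } :
      WithSeminorm p →ₗ[ℂ] ℂ) b hb).fromCompletion

/-- The image in `E_p` of a vector of `E`. -/
noncomputable def LocalBanach.of (p : Seminorm ℂ E) : E →ₗ[ℂ] LocalBanach p where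
  toFun x := UniformSpace.Completion.coe' (show WithSeminorm p from x)
  map_add' x y := UniformSpace.Completion.coe_add (α := WithSeminorm p) x y
  map_smul' c x := UniformSpace.Completion.coe_smul (X := WithSeminorm p) c x

lemma LocalBanach.functional_of (p : Seminorm ℂ E) (φ : E →ₗ[ℂ] ℂ) (b : ℝ)
    (hb : ∀ x, ‖φ x‖ ≤ b * p x) (x : E) :
    LocalBanach.functional p φ b hb (LocalBanach.of p x) = φ x :=
  ContinuousLinearMap.fromCompletion_apply_coe _ _

lemma LocalBanach.norm_of (p : Seminorm ℂ E) (x : E) : ‖LocalBanach.of p x‖ = p x :=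
  UniformSpace.Completion.norm_coe (E := WithSeminorm p) x

lemma linkingMap_of {p q : Seminorm ℂ E} (h : p ≤ q) (x : E) :
    linkingMap h (LocalBanach.of q x) = LocalBanach.of p x :=
  ContinuousLinearMap.completion_apply_coe _ _

lemma LocalBanach.denseRange_of (p : Seminorm ℂ E) : DenseRange (LocalBanach.of p) :=
  UniformSpace.Completion.denseRange_coe (α := WithSeminorm p)

lemma LocalBanach.induction_on {p : Seminorm ℂ E} {P : LocalBanach p → Prop}
    (y : LocalBanach p) (hc : IsClosed {y | P y}) (h : ∀ x : E, P (LocalBanach.of p x)) : P y :=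
  UniformSpace.Completion.induction_on y hc h

lemma LocalBanach.norm_functional_le (p : Seminorm ℂ E) (φ : E →ₗ[ℂ] ℂ) {b : ℝ} (hb0 : 0 ≤ b)
    (hb : ∀ x, ‖φ x‖ ≤ b * p x) : ‖LocalBanach.functional p φ b hb‖ ≤ b := by
  refine ContinuousLinearMap.opNorm_le_bound _ hb0 fun y => ?_
  refine LocalBanach.induction_on y (isClosed_le (ContinuousLinearMap.continuous _).norm
    (continuous_norm.const_mul b)) fun x => ?_
  rw [LocalBanach.functional_of, LocalBanach.norm_of]
  exact hb x

/-- If every `x ∈ E` has the expansion `x = ∑ᵢ φᵢ(x) eᵢ` in `E_p`, and if `∑ᵢ bᵢ p(eᵢ) < ∞` for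
bounds `|φᵢ| ≤ bᵢ q`, then this expansion exhibits `E_q → E_p` as a nuclear operator. -/
lemma isNuclearOperator_linkingMap_of_hasSum {p q : Seminorm ℂ E} (h : p ≤ q) {ι : Type*}
    [Countable ι] [Infinite ι] (e : ι → E) (φ : ι → E →ₗ[ℂ] ℂ) (b : ι → ℝ) (hb0 : ∀ i, 0 ≤ b i)
    (hb : ∀ i x, ‖φ i x‖ ≤ b i * q x) (hsum : Summable fun i => b i * p (e i))
    (hexp : ∀ x, HasSum (fun i => φ i x • LocalBanach.of p (e i)) (LocalBanach.of p x)) :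
    IsNuclearOperator (linkingMap h) := by
  refine isNuclearOperator_of_hasSum_of_dense (linkingMap h)
    (fun i => LocalBanach.functional q (φ i) (b i) (hb i)) (fun i => LocalBanach.of p (e i))
    (Summable.of_nonneg_of_le (fun i => by positivity) (fun i => ?_) hsum)
    (LocalBanach.denseRange_of q) fun x => ?_
  · rw [LocalBanach.norm_of]
    exact mul_le_mul_of_nonneg_right (LocalBanach.norm_functional_le q (φ i) (hb0 i) (hb i))
      (apply_nonneg p _)
  · simpa only [LocalBanach.functional_of, linkingMap_of] using hexp x

/-- The trace estimate: a nuclear map `E_q → E_p` has bounded diagonal sums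
`∑ᵢ 1 / q(eᵢ)` along every biorthogonal system `(eᵢ, φᵢ)` with `∑ᵢ |φᵢ| ≤ p`. -/
lemma IsNuclearOperator.exists_sum_inv_le {p q : Seminorm ℂ E} {h : p ≤ q}
    (hT : IsNuclearOperator (linkingMap h)) {ι : Type*} (e : ι → E) (φ : ι → E →ₗ[ℂ] ℂ)
    (hφe : ∀ i, φ i (e i) = 1) (hφ : ∀ (F : Finset ι) (x : E), ∑ i ∈ F, ‖φ i x‖ ≤ p x)
    (w : ι → ℝ) (hw : ∀ i, 0 < w i) (hqw : ∀ i, q (e i) ≤ w i) :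
    ∃ C : ℝ, ∀ F : Finset ι, ∑ i ∈ F, (w i)⁻¹ ≤ C := by
  obtain ⟨f, y, hfy, hT⟩ := hT
  refine ⟨∑' n, ‖f n‖ * ‖y n‖, fun F => ?_⟩
  let ψ : ι → (LocalBanach p →L[ℂ] ℂ) := fun i =>
    LocalBanach.functional p (φ i) 1 fun x => by simpa using hφ {i} x
  have hψ : ∀ z, ∑ i ∈ F, ‖ψ i z‖ ≤ ‖z‖ := fun z => by
    refine LocalBanach.induction_on z (isClosed_le
      (continuous_finsetSum F fun i _ => (ψ i).continuous.norm) continuous_norm) fun x => ?_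
    simpa only [ψ, LocalBanach.functional_of, LocalBanach.norm_of] using hφ F x
  have hψ1 : ∀ i z, ‖ψ i z‖ ≤ ‖z‖ := fun i z => by
    refine LocalBanach.induction_on z
      (isClosed_le (ψ i).continuous.norm continuous_norm) fun x => ?_
    simpa [ψ, LocalBanach.functional_of, LocalBanach.norm_of] using hφ {i} x
  have hs : ∀ i, Summable fun n => ‖f n‖ * ‖ψ i (y n)‖ := fun i =>
    Summable.of_nonneg_of_le (fun n => by positivity)
      (fun n => mul_le_mul_of_nonneg_left (hψ1 i _) (norm_nonneg _)) hfy
  -- Apply `φᵢ` to the expansion of the image of `eᵢ`.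
  have h1 : ∀ i, (w i)⁻¹ ≤ ∑' n, ‖f n‖ * ‖ψ i (y n)‖ := fun i => by
    have h2 : HasSum (fun n => f n (LocalBanach.of q (e i)) • ψ i (y n)) 1 := by
      have := (hT (LocalBanach.of q (e i))).mapL (ψ i)
      rw [linkingMap_of, LocalBanach.functional_of, hφe] at this
      simpa only [map_smul] using this
    have h3 : ∀ n, ‖f n (LocalBanach.of q (e i)) • ψ i (y n)‖ ≤
        w i * (‖f n‖ * ‖ψ i (y n)‖) := fun n => by
      rw [norm_smul, ← mul_assoc, mul_comm (w i)]
      refine mul_le_mul_of_nonneg_right ?_ (norm_nonneg _)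
      refine ((f n).le_opNorm _).trans (mul_le_mul_of_nonneg_left ?_ (norm_nonneg _))
      rw [LocalBanach.norm_of]
      exact hqw i
    have h4 := tsum_of_norm_bounded ((hs i).hasSum.mul_left (w i)) h3
    rw [h2.tsum_eq, norm_one] at h4
    rwa [inv_le_iff_one_le_mul₀' (hw i)]
  calc ∑ i ∈ F, (w i)⁻¹ ≤ ∑ i ∈ F, ∑' n, ‖f n‖ * ‖ψ i (y n)‖ := Finset.sum_le_sum fun i _ => h1 i
    _ = ∑' n, ∑ i ∈ F, ‖f n‖ * ‖ψ i (y n)‖ := (Summable.tsum_finsetSum fun i _ => hs i).symm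
    _ ≤ ∑' n, ‖f n‖ * ‖y n‖ := by
      refine Summable.tsum_le_tsum (fun n => ?_) (summable_sum fun i _ => hs i) hfy
      rw [← Finset.mul_sum]
      exact mul_le_mul_of_nonneg_left (hψ _) (norm_nonneg _)

end LocalBanach

/-! ### The standard basis of `A_σ(G)` -/

section Basis

variable {G : Type*} (L : G → ℕ) (σ : GrowthFunction)

lemma GrowthFunction.pos (n : ℕ) : 0 < σ n := zero_lt_one.trans_le (σ.one_le n)

/-- The coefficient `a ↦ a_g`, as a linear functional. -/
def ASigma.coeffₗ (g : G) : ASigma L σ →ₗ[ℂ] ℂ where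
  toFun a := a.coeff g
  map_add' _ _ := rfl
  map_smul' _ _ := rfl

variable {L σ} in
lemma ASigma.coeffₗ_apply (g : G) (a : ASigma L σ) : ASigma.coeffₗ L σ g a = a.coeff g := rfl

open Classical in
/-- The basis vector `e_g` of `A_σ(G)`. -/
noncomputable def ASigma.basisVec (g : G) : ASigma L σ :=
  ⟨Pi.single g 1, (Submodule.mem_iInf _).2 fun _ =>
    summable_of_ne_finset_zero (s := {g}) fun h hh => by
      simp [Pi.single_eq_of_ne (Finset.notMem_singleton.1 hh)]⟩

variable {L σ}

open Classical in
lemma ASigma.coeff_basisVec (g h : G) :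
    (ASigma.basisVec L σ g).coeff h = if h = g then 1 else 0 :=
  Pi.single_apply g (1 : ℂ) h

lemma ASigma.weightedNorm_apply (R : ℝ≥0) (a : ASigma L σ) :
    ASigma.weightedNorm L σ R a = ∑' g, ‖a.coeff g‖ * σ (L g) ^ (R : ℝ) := rfl

lemma ASigma.weightedNorm_basisVec (R : ℝ≥0) (g : G) :
    ASigma.weightedNorm L σ R (ASigma.basisVec L σ g) = σ (L g) ^ (R : ℝ) := by
  rw [ASigma.weightedNorm_apply, tsum_eq_single g fun h hh => by simp [coeff_basisVec, hh]]
  simp [coeff_basisVec]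

lemma ASigma.sum_norm_coeff_le (R : ℝ≥0) (a : ASigma L σ) (F : Finset G) :
    ∑ g ∈ F, ‖a.coeff g‖ * σ (L g) ^ (R : ℝ) ≤ ASigma.weightedNorm L σ R a :=
  (a.summable R).sum_le_tsum F fun _ _ => mul_nonneg (norm_nonneg _) (weight_nonneg L σ R _)

lemma ASigma.weightedNorm_mono : Monotone (ASigma.weightedNorm L σ) := fun R R' h a =>
  (a.summable R).tsum_le_tsum (fun _ => mul_le_mul_of_nonneg_left
    (Real.rpow_le_rpow_of_exponent_le (σ.one_le _) h) (norm_nonneg _)) (a.summable R')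

/-- The norms `‖·‖_{L,σ,R}` are directed, so a single one dominates a continuous seminorm. -/
lemma ASigma.exists_le_smul_weightedNorm (p : Seminorm ℂ (ASigma L σ)) (hp : Continuous p) :
    ∃ (R C : ℝ≥0), C ≠ 0 ∧ p ≤ C • ASigma.weightedNorm L σ R := by
  obtain ⟨s, C, hC, hpC⟩ := Seminorm.bound_of_continuous (ASigma.withSeminorms L σ) p hp
  refine ⟨s.sup id, C, hC, fun a => (hpC a).trans ?_⟩
  exact mul_le_mul_of_nonneg_left
    (Finset.sup_le (f := ASigma.weightedNorm L σ) (a := ASigma.weightedNorm L σ (s.sup id))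
      (fun R hR => weightedNorm_mono (Finset.le_sup (f := id) hR)) a) C.2

lemma ASigma.coeff_sum_basisVec (a : ASigma L σ) (F : Finset G) (g : G) [Decidable (g ∈ F)] :
    (∑ h ∈ F, ASigma.coeffₗ L σ h a • ASigma.basisVec L σ h).coeff g =
      if g ∈ F then a.coeff g else 0 := by
  classical
  change ASigma.coeffₗ L σ g _ = _
  rw [map_sum]
  simp only [map_smul]
  change ∑ h ∈ F, a.coeff h • (basisVec L σ h).coeff g = _
  simp [coeff_basisVec]

lemma ASigma.tendsto_weightedNorm_sub (a : ASigma L σ) (R : ℝ≥0) :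
    Tendsto (fun F : Finset G => ASigma.weightedNorm L σ R
      (∑ g ∈ F, ASigma.coeffₗ L σ g a • ASigma.basisVec L σ g - a)) atTop (𝓝 0) := by
  classical
  refine (tendsto_tsum_compl_atTop_zero
    fun g => ‖a.coeff g‖ * σ (L g) ^ (R : ℝ)).congr fun F => ?_
  rw [weightedNorm_apply]
  refine (tsum_subtype {g | g ∉ F} fun g => ‖a.coeff g‖ * σ (L g) ^ (R : ℝ)).trans
    (tsum_congr fun g => ?_)
  have : (∑ g ∈ F, ASigma.coeffₗ L σ g a • ASigma.basisVec L σ g - a).coeff g =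
      (if g ∈ F then a.coeff g else 0) - a.coeff g := by
    rw [← coeff_sum_basisVec]; rfl
  rw [this]
  by_cases hg : g ∈ F <;> simp [hg]

lemma ASigma.hasSum_basisVec {p : Seminorm ℂ (ASigma L σ)} (hp : Continuous p)
    (a : ASigma L σ) :
    HasSum (fun g => ASigma.coeffₗ L σ g a • LocalBanach.of p (ASigma.basisVec L σ g))
      (LocalBanach.of p a) := by
  obtain ⟨R, C, -, hpC⟩ := exists_le_smul_weightedNorm p hp
  rw [HasSum, SummationFilter.unconditional_filter, tendsto_iff_norm_sub_tendsto_zero]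
  refine squeeze_zero (fun _ => norm_nonneg _) (fun F => ?_)
    (by simpa using (tendsto_weightedNorm_sub a R).const_mul (C : ℝ))
  simp only [← map_smul, ← map_sum, ← map_sub, LocalBanach.norm_of]
  exact hpC _

/-- Nuclearity of `A_σ(G)` follows from the summability of a negative power of the weight. -/
lemma ASigma.isNuclearSpace_of_summable [Countable G] [Infinite G] (M : ℝ≥0)
    (hM : Summable fun g => (σ (L g) ^ (M : ℝ))⁻¹) : IsNuclearSpace (ASigma L σ) := by
  intro p hp
  obtain ⟨R, C, hC, hpC⟩ := exists_le_smul_weightedNorm p hp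
  have hC' : (0 : ℝ) < C := by exact_mod_cast pos_iff_ne_zero.2 hC
  have hq : p ≤ C • weightedNorm L σ (R + M) := fun a => (hpC a).trans
    (mul_le_mul_of_nonneg_left (weightedNorm_mono le_self_add a) C.2)
  -- Raising the exponent by `M` makes `‖e_g‖_R / ‖e_g‖_{R+M} = σ(L g)^{-M}` summable.
  refine ⟨C • weightedNorm L σ (R + M), ?_, hq, ?_⟩
  · exact ((withSeminorms L σ).continuous_seminorm (R + M)).const_smul C
  have hpos : ∀ (g : G) (r : ℝ), 0 < σ (L g) ^ r := fun g r => Real.rpow_pos_of_pos (σ.pos _) r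
  refine isNuclearOperator_linkingMap_of_hasSum hq (basisVec L σ) (coeffₗ L σ)
    (fun g => (C * σ (L g) ^ ((R + M : ℝ≥0) : ℝ))⁻¹)
    (fun g => inv_nonneg.2 (mul_pos hC' (hpos g _)).le) (fun g a => ?_) ?_ (hasSum_basisVec hp)
  · rw [← div_eq_inv_mul, le_div_iff₀ (mul_pos hC' (hpos g _))]
    have := sum_norm_coeff_le (R + M) a {g}
    rw [Finset.sum_singleton] at this
    calc ‖a.coeff g‖ * (C * σ (L g) ^ ((R + M : ℝ≥0) : ℝ))
        = C * (‖a.coeff g‖ * σ (L g) ^ ((R + M : ℝ≥0) : ℝ)) := by ring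
      _ ≤ C * weightedNorm L σ (R + M) a := mul_le_mul_of_nonneg_left this C.2
  · refine Summable.of_nonneg_of_le (fun g => mul_nonneg
      (inv_nonneg.2 (mul_pos hC' (hpos g _)).le) (apply_nonneg p _)) (fun g => ?_) hM
    have h1 : p (basisVec L σ g) ≤ C * σ (L g) ^ (R : ℝ) := by
      rw [← weightedNorm_basisVec]; exact hpC _
    refine (mul_le_mul_of_nonneg_left h1 (inv_nonneg.2 (mul_pos hC' (hpos g _)).le)).trans_eq ?_
    rw [NNReal.coe_add, Real.rpow_add (σ.pos _)]
    have := hpos g R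
    have := hpos g M
    field_simp

/-- In a nuclear `A_σ(G)`, some negative power of the weight has bounded partial sums. -/
lemma ASigma.exists_sum_inv_le_of_isNuclearSpace (h : IsNuclearSpace (ASigma L σ)) :
    ∃ (R : ℝ≥0) (C : ℝ), ∀ F : Finset G, ∑ g ∈ F, (σ (L g) ^ (R : ℝ))⁻¹ ≤ C := by
  obtain ⟨q, hq, hpq, hT⟩ :=
    h (weightedNorm L σ 0) ((withSeminorms L σ).continuous_seminorm 0)
  obtain ⟨R, C, hC, hqC⟩ := exists_le_smul_weightedNorm q hq
  have hC' : (0 : ℝ) < C := by exact_mod_cast pos_iff_ne_zero.2 hC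
  obtain ⟨D, hD⟩ := hT.exists_sum_inv_le (basisVec L σ) (coeffₗ L σ)
    (fun g => by simp [coeffₗ_apply, coeff_basisVec])
    (fun F a => (Finset.sum_le_sum fun g _ => by simp [coeffₗ_apply]).trans
      (sum_norm_coeff_le 0 a F))
    (fun g => C * σ (L g) ^ (R : ℝ)) (fun g => mul_pos hC' (Real.rpow_pos_of_pos (σ.pos _) _))
    (fun g => by rw [← weightedNorm_basisVec]; exact hqC _)
  refine ⟨R, C * D, fun F => ?_⟩
  have := mul_le_mul_of_nonneg_left (hD F) hC'.le
  simpa only [Finset.mul_sum, mul_inv, mul_inv_cancel_left₀ hC'.ne'] using this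

end Basis

/-! ### Volume growth -/

section Growth

variable {G : Type*} {L : G → ℕ}

/-- Spheres are contained in balls, so `∑_g 1 / (β(L g) (1 + L g)²) ≤ ∑ₙ 1 / (1 + n)²`. -/
lemma summable_inv_volumeGrowth_mul (hfin : ∀ n, {g | L g ≤ n}.Finite) :
    Summable fun g => (volumeGrowth L (L g) * (1 + (L g : ℝ)) ^ 2)⁻¹ := by
  have hs : Summable fun n : ℕ => ((1 + (n : ℝ)) ^ 2)⁻¹ := by
    have := (summable_nat_add_iff 1).2 (Real.summable_nat_pow_inv.2 one_lt_two)
    simpa [add_comm] using this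
  have h0 : ∀ n : ℕ, 0 ≤ (volumeGrowth L n * (1 + (n : ℝ)) ^ 2)⁻¹ := fun n => by
    have : 0 ≤ volumeGrowth L n := Nat.cast_nonneg _
    positivity
  refine summable_of_sum_le (c := ∑' n : ℕ, ((1 + (n : ℝ)) ^ 2)⁻¹) (fun g => h0 _) fun F => ?_
  rw [Finset.sum_comp (fun n : ℕ => (volumeGrowth L n * (1 + (n : ℝ)) ^ 2)⁻¹) L]
  refine (Finset.sum_le_sum fun n _ => ?_).trans (hs.sum_le_tsum (F.image L) fun n _ => by positivity)
  have hcard : ((F.filter fun g => L g = n).card : ℝ) ≤ volumeGrowth L n := by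
    rw [volumeGrowth, Nat.cast_le, ← Set.ncard_coe_finset]
    refine Set.ncard_le_ncard (fun g hg => ?_) (hfin n)
    exact (Finset.mem_filter.1 hg).2.le
  rw [nsmul_eq_mul, mul_inv, ← mul_assoc]
  refine mul_le_of_le_one_left (by positivity) ?_
  rw [← div_eq_mul_inv]
  exact div_le_one_of_le₀ hcard (Nat.cast_nonneg _)

/-- Almost submultiplicativity absorbs the rescaling of the argument: `σ (c n) ≤ C σ(n)^k`. -/
lemma AlmostSubmultiplicative.exists_le_rpow {σ : GrowthFunction} (hσ : AlmostSubmultiplicative σ)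
    (c : ℕ) : ∃ C k : ℝ, 0 < C ∧ 0 ≤ k ∧ ∀ n, σ (c * n) ≤ C * σ n ^ k := by
  obtain ⟨D, hD, h⟩ := hσ 1 one_pos
  induction c with
  | zero => exact ⟨σ 0, 0, σ.pos 0, le_rfl, fun n => by simp⟩
  | succ c ih =>
    obtain ⟨C, k, hC, hk, ih⟩ := ih
    refine ⟨D * C ^ (1 + 1 : ℝ), k * (1 + 1) + (1 + 1), by positivity, by positivity, fun n => ?_⟩
    have hn := σ.pos n
    calc σ ((c + 1) * n) = σ (c * n + n) := by rw [Nat.succ_mul]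
      _ ≤ D * σ (c * n) ^ (1 + 1 : ℝ) * σ n ^ (1 + 1 : ℝ) := h _ _
      _ ≤ D * (C * σ n ^ k) ^ (1 + 1 : ℝ) * σ n ^ (1 + 1 : ℝ) := by
        gcongr
        · exact (σ.pos _).le
        · exact ih n
      _ = D * C ^ (1 + 1 : ℝ) * σ n ^ (k * (1 + 1) + (1 + 1)) := by
        rw [Real.mul_rpow hC.le (by positivity), ← Real.rpow_mul hn.le,
          Real.rpow_add hn (k * (1 + 1))]
        simp only [mul_assoc]

lemma GrowthLE.exists_le_rpow {f : ℕ → ℝ} {σ : GrowthFunction} (h : GrowthLE f σ)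
    (hσ : AlmostSubmultiplicative σ) :
    ∃ C k : ℝ, 0 < C ∧ 0 ≤ k ∧ ∀ n, f n ≤ C * σ n ^ k := by
  obtain ⟨c, k, hc, hk, h⟩ := h
  obtain ⟨C, l, hC, hl, hσ⟩ := hσ.exists_le_rpow c
  have hc' : (0 : ℝ) < c := by exact_mod_cast hc
  refine ⟨c * C ^ k, l * k, by positivity, by positivity, fun n => (h n).trans ?_⟩
  have hn := σ.pos n
  rw [mul_assoc, Real.rpow_mul hn.le, ← Real.mul_rpow hC.le (by positivity)]
  gcongr
  · exact (σ.pos _).le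
  · exact hσ n

lemma GrowthLE.of_le_mul_rpow {f : ℕ → ℝ} {σ : GrowthFunction} (C k : ℝ)
    (h : ∀ n, f n ≤ C * σ n ^ k) : GrowthLE f σ := by
  refine ⟨max 1 ⌈C⌉₊, max 1 k, le_max_left _ _, le_max_left _ _, fun n => (h n).trans ?_⟩
  have hpos : ∀ n (r : ℝ), 0 ≤ σ n ^ r := fun n r => Real.rpow_nonneg (σ.pos n).le r
  have h1 : C ≤ (max 1 ⌈C⌉₊ : ℕ) := (Nat.le_ceil C).trans (by exact_mod_cast le_max_right _ _)
  have h2 : n ≤ max 1 ⌈C⌉₊ * n := Nat.le_mul_of_pos_left n (by positivity)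
  calc C * σ n ^ k ≤ (max 1 ⌈C⌉₊ : ℕ) * σ n ^ k := mul_le_mul_of_nonneg_right h1 (hpos _ _)
    _ ≤ (max 1 ⌈C⌉₊ : ℕ) * σ (max 1 ⌈C⌉₊ * n) ^ max 1 k := by
      refine mul_le_mul_of_nonneg_left ?_ (Nat.cast_nonneg _)
      exact (Real.rpow_le_rpow_of_exponent_le (σ.one_le n) (le_max_right 1 k)).trans
        (Real.rpow_le_rpow (σ.pos n).le (σ.mono h2) (by positivity))

/-- Nuclearity of `A_σ(G)` is governed by the volume growth, for any length function with finite
balls. -/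
theorem isNuclearSpace_iff_growthLE [Infinite G] (hfin : ∀ n, {g | L g ≤ n}.Finite)
    {σ : GrowthFunction} (hσ : AlmostSubmultiplicative σ)
    (hlin : GrowthLE (fun n : ℕ => 1 + (n : ℝ)) σ) :
    IsNuclearSpace (ASigma L σ) ↔ GrowthLE (volumeGrowth L) σ := by
  constructor
  · intro h
    obtain ⟨R, C, h⟩ := ASigma.exists_sum_inv_le_of_isNuclearSpace h
    refine GrowthLE.of_le_mul_rpow C R fun n => ?_
    have hn : 0 < σ n ^ (R : ℝ) := Real.rpow_pos_of_pos (σ.pos n) _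
    rw [← div_le_iff₀ hn]
    refine le_trans ?_ (h (hfin n).toFinset)
    rw [volumeGrowth, Set.ncard_eq_toFinset_card _ (hfin n), div_eq_mul_inv, ← nsmul_eq_mul]
    refine Finset.card_nsmul_le_sum _ _ _ fun g hg => ?_
    refine inv_anti₀ (Real.rpow_pos_of_pos (σ.pos _) _) ?_
    exact Real.rpow_le_rpow (σ.pos _).le (σ.mono (by simpa using hg)) R.2
  · intro h
    have : Countable G := by
      refine Set.countable_univ_iff.1 ((Set.countable_iUnion fun n => (hfin n).countable).mono ?_)
      exact fun g _ => Set.mem_iUnion.2 ⟨L g, le_refl (L g)⟩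
    obtain ⟨A, a, hA, ha, hβ⟩ := h.exists_le_rpow hσ
    obtain ⟨B, b, hB, hb, hlin⟩ := hlin.exists_le_rpow hσ
    -- `β(n) (1 + n)²` is bounded by a multiple of `σ(n) ^ (a + 2 b)`.
    have hM : 0 ≤ a + b * (2 : ℕ) := by positivity
    refine ASigma.isNuclearSpace_of_summable (Real.toNNReal (a + b * (2 : ℕ))) ?_
    rw [Real.coe_toNNReal _ hM]
    refine Summable.of_nonneg_of_le
      (fun g => inv_nonneg.2 (Real.rpow_nonneg (σ.pos _).le _)) (fun g => ?_)
      ((summable_inv_volumeGrowth_mul hfin).mul_left (A * B ^ 2))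
    have hg := σ.pos (L g)
    have hvol : 0 < volumeGrowth L (L g) := by
      rw [volumeGrowth, Nat.cast_pos]
      exact (Set.ncard_pos (hfin _)).2 ⟨g, le_refl (L g)⟩
    rw [← div_eq_mul_inv, inv_le_iff_one_le_mul₀ (Real.rpow_pos_of_pos hg _),
      div_mul_eq_mul_div, one_le_div (by positivity)]
    calc volumeGrowth L (L g) * (1 + (L g : ℝ)) ^ 2
        ≤ (A * σ (L g) ^ a) * (B * σ (L g) ^ b) ^ 2 := by
          gcongr
          · exact hβ _
          · exact hlin _
      _ = A * B ^ 2 * σ (L g) ^ (a + b * (2 : ℕ)) := by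
          rw [Real.rpow_add hg, Real.rpow_mul_natCast hg.le]
          ring

end Growth

/-! ### Finiteness of balls for the word length -/

/-- Every element is a product of letters from `S`, so the infimum defining the word length is
attained, and a ball is the image of the finite set of words of bounded length. -/
lemma finite_wordLength_le {G : Type*} [Group G] (S : Finset G)
    (hS : Subgroup.closure (S : Set G) = ⊤) (hSinv : ∀ s ∈ S, s⁻¹ ∈ S) (n : ℕ) :
    {g | wordLength (S : Set G) g ≤ n}.Finite := by
  have hS' : ((S : Set G) ∪ (S : Set G)⁻¹) = S :=
    Set.union_eq_left.2 fun s hs => by simpa using hSinv _ hs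
  refine ((List.finite_length_le S n).image fun w => (w.map Subtype.val).prod).subset
    fun g hg => ?_
  have hne : {n : ℕ | ∃ w : List G, (∀ s ∈ w, s ∈ (S : Set G)) ∧ w.prod = g ∧
      w.length = n}.Nonempty := by
    have hg : g ∈ Submonoid.closure (S : Set G) := by
      rw [← hS', ← Subgroup.closure_toSubmonoid, hS]
      trivial
    obtain ⟨w, hw, hwg⟩ := Submonoid.exists_list_of_mem_closure hg
    exact ⟨w.length, w, hw, hwg, rfl⟩
  obtain ⟨w, hw, hwg, hwn⟩ := Nat.sInf_mem hne
  refine ⟨w.attach.map fun s => ⟨s.1, hw s.1 s.2⟩, ?_, ?_⟩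
  · simpa using hwn.trans_le hg
  · simpa using hwg

end WeightedGroup

theorem mainTheorem1 {G : Type*} [Group G] [Infinite G]
    (S : Finset G) (hS : Subgroup.closure (S : Set G) = ⊤) (hSinv : ∀ s ∈ S, s⁻¹ ∈ S)
    (σ : WeightedGroup.GrowthFunction) (hσ : WeightedGroup.AlmostSubmultiplicative σ)
    (hlin : WeightedGroup.GrowthLE (fun n : ℕ => 1 + (n : ℝ)) σ) :
    WeightedGroup.IsNuclearSpace
        (WeightedGroup.ASigma (WeightedGroup.wordLength (S : Set G)) σ) ↔
      WeightedGroup.GrowthLE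
        (WeightedGroup.volumeGrowth (WeightedGroup.wordLength (S : Set G))) σ :=
  WeightedGroup.isNuclearSpace_iff_growthLE
    (WeightedGroup.finite_wordLength_le S hS hSinv) hσ hlin
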